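/- Let $p$ be an odd prime with $p \equiv 2 \pmod{3}$, and let $F$ be a finite field of characteristic $p$ and order $q = p^n$. Let $\mathrm{Tr}\colon F \to \mathbb{F}_p$ be the absolute trace and $\psi(x) = e^{2\pi i\,\mathrm{Tr}(x)/p}$ the canonical additive character of $F$. For a positive integer $d$ and $a \in F$ put $$W_{F,d}(a) = \sum_{x \in F} \psi(x^d - a x), \qquad V_{F,d} = \min_{a \in F} \mathrm{val}_p\big(W_{F,d}(a)\big),$$ where $\mathrm{val}_p$ is the $p$-adic valuation of $\mathbb{Q}$ extended to $\mathbb{Q}(e^{2\pi i/p})$, so that $\mathrm{val}_p(1-e^{2\pi i/p}) = 1/(p-1)$ and $\mathrm{val}_p(0)=\infty$. Then $3 \not\equiv 1 \pmod{p-1}$. We have $\gcd(3,q-1)=1$ if and only if $q \equiv 2 \pmod 3$. In that case $d = (2q-1)/3$ is an integer and is the multiplicative inverse of $3$ modulo $q-1$, we have $$V_{F,3} = V_{F,d} = n \cdot \frac{p+1}{3(p-1)},$$ and $d \not\equiv 1 \pmod{p-1}$. -/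

import Mathlib

open scoped NumberField

namespace WeilSum

/-- The primitive `p`-th root of unity `e^{2πi/p}` in `ℂ`. -/
noncomputable def zeta (p : ℕ) : ℂ := Complex.exp (2 * Real.pi * Complex.I / p)

/-- The cyclotomic field `ℚ(e^{2πi/p})`, as a subfield of `ℂ`. -/
noncomputable abbrev cyclo (p : ℕ) : IntermediateField ℚ ℂ := IntermediateField.adjoin ℚ {zeta p}

theorem zeta_isPrimitiveRoot (p : ℕ) [hp : Fact p.Prime] : IsPrimitiveRoot (zeta p) p :=
  Complex.isPrimitiveRoot_exp p hp.out.ne_zero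

theorem zeta_mem (p : ℕ) : zeta p ∈ cyclo p :=
  IntermediateField.subset_adjoin ℚ {zeta p} (Set.mem_singleton _)

theorem gen_isPrimitiveRoot (p : ℕ) [Fact p.Prime] :
    IsPrimitiveRoot (⟨zeta p, zeta_mem p⟩ : cyclo p) p :=
  IsPrimitiveRoot.coe_submonoidClass_iff.mp (zeta_isPrimitiveRoot p)

instance cyclo_isCyclotomicExtension (p : ℕ) [Fact p.Prime] :
    IsCyclotomicExtension {p} ℚ (cyclo p) := by
  have h := (zeta_isPrimitiveRoot p).adjoin_isCyclotomicExtension ℚ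
  have hi : IsIntegral ℚ (zeta p) :=
    (zeta_isPrimitiveRoot p).isIntegral (Fact.out : p.Prime).pos |>.tower_top
  change IsCyclotomicExtension {p} ℚ (cyclo p).toSubalgebra
  rw [IntermediateField.adjoin_simple_toSubalgebra_of_isAlgebraic hi.isAlgebraic]
  exact h

instance cyclo_numberField (p : ℕ) [Fact p.Prime] : NumberField (cyclo p) :=
  IsCyclotomicExtension.numberField {p} ℚ (cyclo p)

/-- The prime ideal `(e^{2πi/p} - 1)` of the ring of integers of `ℚ(e^{2πi/p})`; it is the only
prime ideal above `p`. -/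
noncomputable def primeAbove (p : ℕ) [Fact p.Prime] :
    IsDedekindDomain.HeightOneSpectrum (𝓞 (cyclo p)) where
  asIdeal := Ideal.span {(gen_isPrimitiveRoot p).toInteger - 1}
  isPrime := (Ideal.span_singleton_prime (gen_isPrimitiveRoot p).zeta_sub_one_prime'.ne_zero).2
    (gen_isPrimitiveRoot p).zeta_sub_one_prime'
  ne_bot := by
    rw [Ne, Ideal.span_singleton_eq_bot]
    exact (gen_isPrimitiveRoot p).zeta_sub_one_prime'.ne_zero

open Classical in
/-- The `p`-adic valuation on `ℚ(e^{2πi/p})`, written additively, with values in `ℚ ∪ {∞}`: the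
order at the prime above `p`, divided by `p - 1`. So it extends the `p`-adic valuation of `ℚ`, and
`1 - e^{2πi/p}` has valuation `1 / (p - 1)`. -/
noncomputable def val (p : ℕ) [Fact p.Prime] (x : cyclo p) : WithTop ℚ :=
  if x = 0 then ⊤
  else (((-WithZero.log ((primeAbove p).valuation (cyclo p) x) : ℤ) : ℚ) / ((p : ℚ) - 1) : ℚ)

variable (p : ℕ) [Fact p.Prime] (F : Type*) [Field F] [Fintype F] [Algebra (ZMod p) F]

/-- The canonical additive character `x ↦ e^{2πi Tr(x)/p}` of a finite field of characteristic
`p`, where `Tr` is the absolute trace. -/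
noncomputable def canonicalChar (x : F) : ℂ := ZMod.stdAddChar (Algebra.trace (ZMod p) F x)

/-- The Weil sum `W_{F,d}(a) = ∑_{x ∈ F} ψ(x^d - a x)`. -/
noncomputable def weilSum (d : ℕ) (a : F) : ℂ := ∑ x : F, canonicalChar p F (x ^ d - a * x)

theorem stdAddChar_mem (t : ZMod p) : ZMod.stdAddChar t ∈ cyclo p := by
  have h : ZMod.stdAddChar t = zeta p ^ t.val := by
    rw [ZMod.stdAddChar_apply, ZMod.toCircle_apply, zeta, ← Complex.exp_nat_mul]
    congr 1
    ring
  rw [h]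
  exact pow_mem (zeta_mem p) _

theorem weilSum_mem (d : ℕ) (a : F) : weilSum p F d a ∈ cyclo p :=
  sum_mem fun _ _ => stdAddChar_mem p _

/-- `V_{F,d}`, the minimum of the `p`-adic valuation of `W_{F,d}(a)` over all `a ∈ F`. -/
noncomputable def minVal (d : ℕ) : WithTop ℚ :=
  Finset.univ.inf fun a : F => val p ⟨weilSum p F d a, weilSum_mem p F d a⟩

end WeilSum

/-!
Let `ζ = e^{2πi/p}`, `π = ζ - 1` and `q = p ^ n`, and fix a valuation subring `A` of `ℂ` above `p`.
Every nonzero integer of `ℚ(ζ)` is a power of `π` times a unit at the prime `(π)`, so that `A` computes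
`val` on Weil sums (`exists_val_eq_and_valuation_eq`). Since `A` contains all algebraic integers,
its residue field contains `F`, and there is a Teichmüller character of `F` with values in `ℂ`;
let `η` be its inverse (`exists_isInvTeichmuller`).

Stickelberger's theorem (`valuation_gaussSum`) says that for `0 < j < q - 1` the Gauss sum `G(j)` of
`η ^ j` has the valuation of `π` raised to the sum of the base-`p` digits of `j`. The lower bound
holds because `G(1) / π` reduces to `-1`, `G(p j) = G(j)`, and `G(i) G(j)` is `G(i + j)` times an
integral Jacobi sum; it is sharp because `G(j) G(q - 1 - j) = ± q`.

Fourier analysis on `Fˣ` expresses the cubic Weil sums through the products `G(i) G(j)` with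
`3i + j ≡ 0` modulo `q - 1`, and conversely
(`sum_gaussSum_mul_gaussSum`, `sum_cubic_sum_mul_mulChar`). So the minimal valuation is the least
digit sum of `i` plus that of `j` over such pairs, divided by `p - 1`. An analysis of carries
(`le_digits_sum_add_digits_sum`) bounds it from below by `n (p + 1) / 3`; when all digits of `i` are
`(p - 2) / 3` and all digits of `j` are `1`, this value is attained. Finally, the sums for the
exponent `d` with `3d ≡ 1` modulo `q - 1` are, up to a bijection of `Fˣ`, those for the exponent `3`
(`sum_pow_inverse_eq_cubic_sum`).
-/

open scoped NumberField

namespace WeilSum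

/-! ### Sums of base-`p` digits -/

theorem digits_sum_eq_mod_add_div {p : ℕ} (hp : 1 < p) (m : ℕ) :
    (Nat.digits p m).sum = m % p + (Nat.digits p (m / p)).sum := by
  rcases Nat.eq_zero_or_pos m with rfl | hm
  · simp
  · rw [Nat.digits_def' hp hm, List.sum_cons]

theorem digits_sum_mul_add {p : ℕ} (hp : 1 < p) (m : ℕ) {r : ℕ} (hr : r < p) :
    (Nat.digits p (p * m + r)).sum = r + (Nat.digits p m).sum := by
  rw [digits_sum_eq_mod_add_div hp, Nat.mul_add_mod, Nat.mod_eq_of_lt hr,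
    Nat.mul_add_div (by omega), Nat.div_eq_of_lt hr, Nat.add_zero]

/-- Subtraction from `p ^ n - 1` replaces each of the `n` digits `r` by `p - 1 - r`. -/
theorem digits_sum_complement {p : ℕ} (hp : 1 < p) (n : ℕ) :
    ∀ i j : ℕ, i + j + 1 = p ^ n →
      (Nat.digits p i).sum + (Nat.digits p j).sum = n * (p - 1) := by
  induction n with
  | zero =>
    intro i j h
    obtain ⟨rfl, rfl⟩ : i = 0 ∧ j = 0 := by simp at h; omega
    simp
  | succ n ih =>
    intro i j h
    have hi := Nat.div_add_mod i p
    have hj := Nat.div_add_mod j p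
    have hir := Nat.mod_lt i (by omega : p > 0)
    have hjr := Nat.mod_lt j (by omega : p > 0)
    rw [digits_sum_eq_mod_add_div hp i, digits_sum_eq_mod_add_div hp j]
    generalize i / p = i' at *
    generalize i % p = r at *
    generalize j / p = j' at *
    generalize j % p = s at *
    have key : p * (i' + j') + (r + s + 1) = p * p ^ n := by
      rw [mul_add, ← pow_succ']; omega
    -- `r + s + 1` is divisible by `p` and lies strictly between `0` and `2p`.
    have hd : p ∣ r + s + 1 := (Nat.dvd_add_right (dvd_mul_right p _)).1 (key ▸ dvd_mul_right p _)
    obtain ⟨c, hc⟩ := hd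
    have hc1 : c = 1 := by
      have h1 : 0 < c := Nat.pos_of_ne_zero (by rintro rfl; omega)
      have h2 : c < 2 := by
        by_contra hcon
        have : p * 2 ≤ p * c := Nat.mul_le_mul_left p (by omega)
        omega
      omega
    subst hc1
    have h3 : i' + j' + 1 = p ^ n := by
      apply Nat.eq_of_mul_eq_mul_left (by omega : 0 < p)
      rw [← key, hc]; ring
    have := ih i' j' h3
    rw [Nat.succ_mul]
    omega

/-- The number `r (1 + p + ⋯ + p ^ (n - 1))` has `n` digits equal to `r`. -/
theorem digits_sum_repdigit {p : ℕ} (hp : 1 < p) {r : ℕ} (hr : r < p) (n : ℕ) :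
    (Nat.digits p (r * ∑ k ∈ Finset.range n, p ^ k)).sum = n * r := by
  induction n with
  | zero => simp
  | succ n ih =>
    have : r * ∑ k ∈ Finset.range (n + 1), p ^ k
        = p * (r * ∑ k ∈ Finset.range n, p ^ k) + r := by
      rw [Finset.sum_range_succ', pow_zero, Finset.sum_congr rfl fun k _ => pow_succ' p k,
        ← Finset.mul_sum]
      ring
    rw [this, digits_sum_mul_add hp _ hr, ih]
    ring

/-- The digit-sum inequality behind the lower bound for the valuations. Writing
`3i + j + b = c p ^ n` digit by digit yields a chain of carries in `{1, 2, 3}` from `b` to `c`.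
A step with digits `i₀`, `j₀` and carries `b → b'` satisfies `3i₀ + j₀ + b = p b'`, and costs
`i₀ + j₀`; the carry `2` is credited with one unit, which makes every step cost at least
`(p + 1) / 3`. -/
theorem le_digits_sum_add_digits_sum {p : ℕ} (hp : 5 ≤ p) (hp3 : p % 3 = 2) (n : ℕ) :
    ∀ i j b c : ℕ, i < p ^ n → j < p ^ n → 1 ≤ b → b ≤ 3 → 1 ≤ c → c ≤ 3 →
      3 * i + j + b = c * p ^ n →
      n * (p + 1) + (if c = 2 then 3 else 0) ≤
        3 * ((Nat.digits p i).sum + (Nat.digits p j).sum) + (if b = 2 then 3 else 0) := by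
  have hp1 : 1 < p := by omega
  induction n with
  | zero =>
    intro i j b c hi hj hb hb' hc hc' h
    obtain ⟨rfl, rfl⟩ : i = 0 ∧ j = 0 := by simp at hi hj; omega
    obtain rfl : b = c := by simpa using h
    simp
  | succ n ih =>
    intro i j b c hi hj hb hb' hc hc' h
    have hi' : i / p < p ^ n := Nat.div_lt_of_lt_mul (by rwa [← pow_succ'])
    have hj' : j / p < p ^ n := Nat.div_lt_of_lt_mul (by rwa [← pow_succ'])
    have hid := Nat.div_add_mod i p
    have hjd := Nat.div_add_mod j p
    have hir := Nat.mod_lt i (by omega : p > 0)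
    have hjr := Nat.mod_lt j (by omega : p > 0)
    rw [digits_sum_eq_mod_add_div hp1 i, digits_sum_eq_mod_add_div hp1 j]
    generalize i / p = i' at *
    generalize i % p = r at *
    generalize j / p = j' at *
    generalize j % p = s at *
    have key : p * (3 * i' + j') + (3 * r + s + b) = p * (c * p ^ n) := by
      have : p * (c * p ^ n) = c * p ^ (n + 1) := by ring
      rw [this, ← h, ← hid, ← hjd]; ring
    have hd : p ∣ 3 * r + s + b :=
      (Nat.dvd_add_right (dvd_mul_right p _)).1 (key ▸ dvd_mul_right p _)
    obtain ⟨b', hb'd⟩ := hd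
    have h1 : 1 ≤ b' := Nat.pos_of_ne_zero (by rintro rfl; omega)
    have h2 : b' ≤ 3 := by
      by_contra hcon
      have : p * 4 ≤ p * b' := Nat.mul_le_mul_left p (by omega)
      omega
    have h3 : 3 * i' + j' + b' = c * p ^ n := by
      apply Nat.eq_of_mul_eq_mul_left (by omega : 0 < p)
      rw [← key, hb'd]; ring
    have IH := ih i' j' b' c hi' hj' h1 h2 hc hc' h3
    have step : (p + 1) + (if b' = 2 then 3 else 0) ≤ 3 * (r + s) + (if b = 2 then 3 else 0) := by
      interval_cases b <;> interval_cases b' <;>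
        simp only [Nat.reduceEqDiff, if_true, if_false] <;> omega
    have hm : (n + 1) * (p + 1) = n * (p + 1) + (p + 1) := by ring
    rw [hm]
    omega

/-! ### Valuation subrings of `ℂ` above `p` -/

theorem valuation_le_one_of_isIntegral (A : ValuationSubring ℂ) {x : ℂ} (hx : IsIntegral ℤ x) :
    A.valuation x ≤ 1 := by
  rw [ValuationSubring.valuation_le_one_iff]
  have : IsIntegral A x := hx.tower_top
  obtain ⟨y, hy⟩ := IsIntegrallyClosed.isIntegral_iff.1 this
  exact hy ▸ y.2

/-- Some valuation of `ℂ` lies above `p`: as `1 / p` is not an algebraic integer, `p` is not a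
unit of the ring of algebraic integers. -/
theorem exists_valuationSubring_lt_one (p : ℕ) [hp : Fact p.Prime] :
    ∃ A : ValuationSubring ℂ, A.valuation (p : ℂ) < 1 := by
  let R : Subring ℂ := (integralClosure ℤ ℂ).toSubring
  let I : Ideal R := Ideal.span {(p : R)}
  have hI : I ≠ ⊤ := by
    intro h
    obtain ⟨u, hu⟩ := (Ideal.span_singleton_eq_top.1 h).exists_right_inv
    have huC : (p : ℂ) * (u : ℂ) = 1 := by exact_mod_cast congrArg (Subtype.val) hu
    have hp0 : (p : ℂ) ≠ 0 := by exact_mod_cast hp.out.ne_zero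
    have hint : IsIntegral ℤ (u : ℂ) := u.2
    have hu' : (u : ℂ) = algebraMap ℚ ℂ (1 / p) := by
      simp only [one_div, map_inv₀, map_natCast]
      exact eq_inv_of_mul_eq_one_right huC
    rw [hu', isIntegral_algebraMap_iff (algebraMap ℚ ℂ).injective] at hint
    obtain ⟨z, hz⟩ := IsIntegrallyClosed.isIntegral_iff.1 hint
    have hz' : (z : ℚ) * p = 1 := by
      have : (z : ℚ) = 1 / p := by simpa using hz
      rw [this, one_div, inv_mul_cancel₀]; exact_mod_cast hp.out.ne_zero
    have hz2 : z * (p : ℤ) = 1 := by exact_mod_cast hz'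
    have : (p : ℤ) ∣ 1 := ⟨z, by rw [mul_comm, hz2]⟩
    exact hp.out.one_lt.ne' (by exact_mod_cast Int.eq_one_of_dvd_one (by positivity) this)
  obtain ⟨B, -, hB⟩ := Ideal.image_subset_nonunits_valuationSubring I hI
  refine ⟨B, ?_⟩
  rw [← ValuationSubring.mem_nonunits_iff]
  exact hB ⟨(p : R), Ideal.subset_span rfl, by simp⟩

/-- The inclusion of the ring of integers of `ℚ(e^{2πi/p})` into `ℂ`. -/
noncomputable def integersToComplex (p : ℕ) : 𝓞 (cyclo p) →+* ℂ :=
  (algebraMap (cyclo p) ℂ).comp (algebraMap (𝓞 (cyclo p)) (cyclo p))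

theorem integersToComplex_toInteger_sub_one (p : ℕ) [Fact p.Prime] :
    integersToComplex p ((gen_isPrimitiveRoot p).toInteger - 1) = zeta p - 1 := by
  rw [map_sub, map_one]
  rfl

theorem valuation_integersToComplex_le_one (A : ValuationSubring ℂ) {p : ℕ} (x : 𝓞 (cyclo p)) :
    A.valuation (integersToComplex p x) ≤ 1 :=
  valuation_le_one_of_isIntegral A
    ((NumberField.RingOfIntegers.isIntegral x).map (integersToComplex p).toIntAlgHom)

/-- `p` and `(ζ - 1) ^ (p - 1)` differ by a unit of `ℤ[ζ]`. -/
theorem valuation_prime_eq (A : ValuationSubring ℂ) (p : ℕ) [Fact p.Prime] :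
    A.valuation (p : ℂ) = A.valuation (zeta p - 1) ^ (p - 1) := by
  obtain ⟨u, hu⟩ := IsCyclotomicExtension.Rat.associated_zeta_sub_one_pow_prime p
    (gen_isPrimitiveRoot p)
  have hu' := congrArg (integersToComplex p) hu
  rw [map_mul, map_pow, integersToComplex_toInteger_sub_one, map_natCast] at hu'
  have h3 := congrArg (fun y => A.valuation (integersToComplex p y)) u.mul_inv
  simp only [map_mul, map_one] at h3
  have h4 : A.valuation (integersToComplex p u) = 1 :=
    le_antisymm (valuation_integersToComplex_le_one A _) <| h3 ▸
      mul_le_of_le_one_right' (valuation_integersToComplex_le_one A _)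
  rw [← hu', map_mul, h4, mul_one, map_pow]

theorem valuation_zeta_sub_one_pos (A : ValuationSubring ℂ) (p : ℕ) [hp : Fact p.Prime] :
    0 < A.valuation (zeta p - 1) := by
  rw [Valuation.pos_iff, sub_ne_zero]
  exact (zeta_isPrimitiveRoot p).ne_one hp.out.one_lt

theorem valuation_zeta_sub_one_lt_one {A : ValuationSubring ℂ} {p : ℕ} [Fact p.Prime]
    (hA : A.valuation (p : ℂ) < 1) : A.valuation (zeta p - 1) < 1 := by
  by_contra h
  rw [valuation_prime_eq] at hA
  exact (one_le_pow_of_one_le' (not_lt.1 h) _).not_gt hA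

/-- On integers of `ℚ(ζ)`, every valuation of `ℂ` above `p` is determined by `val`: an integer
is `(ζ - 1) ^ k` times an integer outside the prime `(ζ - 1)`, and the latter is a unit for both
valuations. -/
theorem exists_val_eq_and_valuation_eq {A : ValuationSubring ℂ} {p : ℕ} [hp : Fact p.Prime]
    (hA : A.valuation (p : ℂ) < 1) {x : cyclo p} (hx : IsIntegral ℤ x) (hx0 : x ≠ 0) :
    ∃ k : ℕ, val p x = (((k : ℚ) / ((p : ℚ) - 1) : ℚ) : WithTop ℚ) ∧
      A.valuation (x : ℂ) = A.valuation (zeta p - 1) ^ k := by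
  obtain ⟨x, rfl⟩ : ∃ y : 𝓞 (cyclo p), (y : cyclo p) = x := ⟨⟨x, hx⟩, rfl⟩
  have hx0' : x ≠ 0 := by rintro rfl; simp at hx0
  set π : 𝓞 (cyclo p) := (gen_isPrimitiveRoot p).toInteger - 1
  have hπ : Prime π := (gen_isPrimitiveRoot p).zeta_sub_one_prime'
  have hπC : integersToComplex p π = zeta p - 1 := integersToComplex_toInteger_sub_one p
  obtain ⟨y, hxy, hy⟩ := (FiniteMultiplicity.of_prime_left hπ hx0').exists_eq_pow_mul_and_not_dvd
  generalize multiplicity π x = k at hxy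
  refine ⟨k, ?_, ?_⟩
  · have hv : (primeAbove p).valuation (cyclo p) (x : cyclo p) = WithZero.exp (-(k : ℤ)) := by
      rw [IsDedekindDomain.HeightOneSpectrum.valuation_of_algebraMap, hxy, map_mul, map_pow,
        IsDedekindDomain.HeightOneSpectrum.intValuation_singleton _ hπ.ne_zero rfl,
        IsDedekindDomain.HeightOneSpectrum.intValuation_eq_one_iff.2, mul_one, ← WithZero.exp_nsmul]
      · simp
      · change y ∉ Ideal.span {π}
        rwa [Ideal.mem_span_singleton]
    rw [val, if_neg hx0, hv]
    simp
  · have hyv : A.valuation (integersToComplex p y) = 1 := by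
      refine le_antisymm (valuation_integersToComplex_le_one A y) (not_lt.1 fun hlt => ?_)
      -- The prime `(π)` is maximal, so that `y` is a unit modulo `π`.
      have hmax : (Ideal.span {π}).IsMaximal := (primeAbove p).isMaximal
      obtain ⟨z, i, hi, hz⟩ := hmax.exists_inv (fun h => hy (Ideal.mem_span_singleton.1 h))
      obtain ⟨t, rfl⟩ := Ideal.mem_span_singleton.1 hi
      have hzC := congrArg (integersToComplex p) hz
      rw [map_add, map_mul, map_mul, map_one, hπC] at hzC
      have h1 : A.valuation (integersToComplex p z * integersToComplex p y) < 1 := by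
        rw [map_mul]
        exact (mul_le_of_le_one_left' (valuation_integersToComplex_le_one A z)).trans_lt hlt
      have h2 : A.valuation ((zeta p - 1) * integersToComplex p t) < 1 := by
        rw [map_mul]
        exact (mul_le_of_le_one_right' (valuation_integersToComplex_le_one A t)).trans_lt
          (valuation_zeta_sub_one_lt_one hA)
      have h3 := A.valuation.map_add_lt h1 h2
      rw [hzC, map_one] at h3
      exact lt_irrefl _ h3
    change A.valuation (integersToComplex p x) = _
    rw [hxy]
    simp only [hyv, hπC, map_mul, map_pow, mul_one]

/-! ### The Teichmüller character -/

open IsLocalRing in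
/-- `η` is the inverse of the Teichmüller character of `F` with respect to the embedding `ι` of
`F` into the residue field of `A`: it lifts `x ↦ (ι x)⁻¹`
(both sides vanish at `0`). -/
def IsInvTeichmuller {F : Type*} [Field F] (A : ValuationSubring ℂ) (ι : F →+* ResidueField A)
    (η : MulChar F ℂ) : Prop :=
  ∀ x, ∃ a : A, (a : ℂ) = η x ∧ residue A a = (ι x)⁻¹

theorem residue_natCast_prime {A : ValuationSubring ℂ} {p : ℕ} (hA : A.valuation (p : ℂ) < 1) :
    (p : IsLocalRing.ResidueField A) = 0 := by
  rw [← map_natCast (IsLocalRing.residue A), IsLocalRing.residue_eq_zero_iff,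
    ValuationSubring.valuation_lt_one_iff]
  simpa using hA

theorem charP_residueField {A : ValuationSubring ℂ} {p : ℕ} [hp : Fact p.Prime]
    (hA : A.valuation (p : ℂ) < 1) : CharP (IsLocalRing.ResidueField A) p :=
  (CharP.charP_iff_prime_eq_zero hp.out).2 (residue_natCast_prime hA)

/-- Reduction is injective on `N`-th roots of unity when `N` is invertible in the residue field:
otherwise `N` would be the reduction of `1 + a + ⋯ + a ^ (N - 1) = 0`. -/
theorem eq_one_of_residue_eq_one {R : Type*} [CommRing R] [IsDomain R] [IsLocalRing R] {N : ℕ}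
    (hN : (N : IsLocalRing.ResidueField R) ≠ 0) {a : R} (ha : a ^ N = 1)
    (har : IsLocalRing.residue R a = 1) : a = 1 := by
  by_contra h
  have h1 : (∑ i ∈ Finset.range N, a ^ i) * (a - 1) = 0 := by rw [geom_sum_mul, ha, sub_self]
  have h2 := (mul_eq_zero.1 h1).resolve_right (sub_ne_zero.2 h)
  apply hN
  have h3 := congrArg (IsLocalRing.residue R) h2
  simpa [har] using h3

theorem eq_of_residue_eq {R : Type*} [CommRing R] [IsDomain R] [IsLocalRing R] {N : ℕ}
    (hN : (N : IsLocalRing.ResidueField R) ≠ 0) {a b : R} (ha : a ^ N = 1) (hb : b ^ N = 1)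
    (hab : IsLocalRing.residue R a = IsLocalRing.residue R b) : a = b := by
  have hN0 : N ≠ 0 := by rintro rfl; simp at hN
  have hb' : b * b ^ (N - 1) = 1 := by rw [← pow_succ', Nat.sub_add_cancel (by omega), hb]
  have h1 : a * b ^ (N - 1) = 1 := by
    apply eq_one_of_residue_eq_one hN
    · rw [mul_pow, ha, ← pow_mul, mul_comm (N - 1), pow_mul, hb, one_pow, one_mul]
    · rw [map_mul, hab, ← map_mul, hb', map_one]
  calc a = a * (b * b ^ (N - 1)) := by rw [hb', mul_one]
    _ = (a * b ^ (N - 1)) * b := by ring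
    _ = b := by rw [h1, one_mul]

open IsLocalRing in
/-- The residue field of a valuation subring of `ℂ` above `p` contains `F`, and the embedding
lifts to a multiplicative character: the `(q - 1)`-th roots of unity in `ℂ` reduce bijectively
to those of the residue field. -/
theorem exists_isInvTeichmuller {A : ValuationSubring ℂ} {p : ℕ} [hp : Fact p.Prime]
    (hA : A.valuation (p : ℂ) < 1) (F : Type*) [Field F] [Fintype F] [Algebra (ZMod p) F] :
    ∃ (ι : F →+* ResidueField A) (η : MulChar F ℂ), IsInvTeichmuller A ι η := by
  classical
  have hchar := charP_residueField hA
  let : Algebra (ZMod p) (ResidueField A) := ZMod.algebra _ p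
  have : CharP F p := charP_of_injective_algebraMap (algebraMap (ZMod p) F).injective p
  obtain ⟨n, -, hcard⟩ := FiniteField.card F p
  set N := Fintype.card F - 1
  have hcard1 : 1 < Fintype.card F := Fintype.one_lt_card
  have hN0 : N ≠ 0 := by omega
  have hNF : N + 1 = Fintype.card F := by omega
  have hN : (N : ResidueField A) ≠ 0 := by
    have h : (N : ResidueField A) + 1 = 0 := by
      rw [← Nat.cast_succ, Nat.succ_eq_add_one, hNF, hcard, Nat.cast_pow, CharP.cast_eq_zero,
        zero_pow n.ne_zero]
    intro h0
    rw [h0, zero_add] at h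
    exact one_ne_zero h
  have hμ := Complex.isPrimitiveRoot_exp N hN0
  set μ' : ℂ := Complex.exp (2 * Real.pi * Complex.I / N)
  have hμA : μ' ∈ A := (A.valuation_le_one_iff _).1
    (valuation_le_one_of_isIntegral A (hμ.isIntegral (Nat.pos_of_ne_zero hN0)))
  set μ : A := ⟨μ', hμA⟩
  have hμA : IsPrimitiveRoot μ N :=
    IsPrimitiveRoot.of_map_of_injective (f := A.subtype) hμ A.subtype_injective
  have hμr : IsPrimitiveRoot (residue A μ) N := by
    refine ⟨by rw [← map_pow, hμA.pow_eq_one, map_one], fun l hl => hμA.dvd_of_pow_eq_one l ?_⟩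
    apply eq_one_of_residue_eq_one hN
    · rw [← pow_mul, mul_comm, pow_mul, hμA.pow_eq_one, one_pow]
    · rw [map_pow, hl]
  have hsplit : ((Polynomial.X ^ Fintype.card F - Polynomial.X : Polynomial (ZMod p)).map
      (algebraMap (ZMod p) (ResidueField A))).Splits := by
    have : ((Polynomial.X ^ Fintype.card F - Polynomial.X : Polynomial (ZMod p)).map
        (algebraMap (ZMod p) (ResidueField A))) =
        Polynomial.X * (Polynomial.X ^ N - 1 : Polynomial (ResidueField A)) := by
      rw [Polynomial.map_sub, Polynomial.map_pow, Polynomial.map_X, ← hNF]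
      ring
    rw [this]
    exact Polynomial.Splits.X.mul (Polynomial.X_pow_sub_one_splits hμr)
  have hspl := FiniteField.isSplittingField_sub F (ZMod p)
  let ι : F →ₐ[ZMod p] ResidueField A :=
    Polynomial.IsSplittingField.lift F (Polynomial.X ^ Fintype.card F - Polynomial.X) hsplit
  have hex : ∀ x : Fˣ, ∃ a : A, a ^ N = 1 ∧ residue A a = ι ((x⁻¹ : Fˣ) : F) := by
    intro x
    have : NeZero N := ⟨hN0⟩
    have hx : ι ((x⁻¹ : Fˣ) : F) ^ N = 1 := by
      rw [← map_pow, FiniteField.pow_card_sub_one_eq_one _ (x⁻¹).ne_zero, map_one]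
    obtain ⟨i, -, hi⟩ := hμr.eq_pow_of_pow_eq_one hx
    refine ⟨μ ^ i, ?_, by rw [map_pow, hi]⟩
    rw [← pow_mul, mul_comm, pow_mul, hμA.pow_eq_one, one_pow]
  choose t ht1 ht2 using hex
  let T : Fˣ →* A :=
    { toFun := t
      map_one' := eq_of_residue_eq hN (ht1 1) (one_pow N) (by simp [ht2])
      map_mul' := fun x y => eq_of_residue_eq hN (ht1 _)
        (by rw [mul_pow, ht1, ht1, one_mul]) (by
          rw [map_mul, ht2, ht2, ht2, ← map_mul, ← Units.val_mul, mul_inv]) }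
  refine ⟨ι, (MulChar.ofUnitHom T.toHomUnits).ringHomComp A.subtype, fun x => ?_⟩
  refine ⟨MulChar.ofUnitHom T.toHomUnits x, rfl, ?_⟩
  rcases eq_or_ne x 0 with rfl | hx
  · rw [MulChar.map_zero, map_zero, map_zero, inv_zero]
  · obtain ⟨u, rfl⟩ := hx.isUnit
    rw [MulChar.ofUnitHom_coe]
    change residue A (t u) = _
    rw [ht2, Units.val_inv_eq_inv_val, map_inv₀]
    rfl

/-! ### Valuations of Gauss sums -/

/-- The canonical additive character as an `AddChar`. -/
noncomputable def canonicalAddChar (p : ℕ) [Fact p.Prime] (F : Type*) [Field F] [Fintype F]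
    [Algebra (ZMod p) F] : AddChar F ℂ :=
  ZMod.stdAddChar.compAddMonoidHom (Algebra.trace (ZMod p) F).toAddMonoidHom

theorem canonicalAddChar_apply (p : ℕ) [Fact p.Prime] {F : Type*} [Field F] [Fintype F]
    [Algebra (ZMod p) F] (x : F) :
    canonicalAddChar p F x = ZMod.stdAddChar (Algebra.trace (ZMod p) F x) := rfl

theorem canonicalAddChar_ne_one (p : ℕ) [Fact p.Prime] (F : Type*) [Field F] [Fintype F]
    [Algebra (ZMod p) F] : canonicalAddChar p F ≠ 1 := by
  intro h
  obtain ⟨x, hx⟩ := Algebra.trace_surjective (ZMod p) F 1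
  have h1 := DFunLike.congr_fun h x
  rw [canonicalAddChar_apply, hx, AddChar.one_apply,
    ← AddChar.map_zero_eq_one (ZMod.stdAddChar (N := p))] at h1
  exact one_ne_zero (ZMod.injective_stdAddChar h1)

theorem canonicalAddChar_pow (p : ℕ) [Fact p.Prime] {F : Type*} [Field F] [Fintype F]
    [Algebra (ZMod p) F] (x : F) : canonicalAddChar p F (x ^ p) = canonicalAddChar p F x := by
  have h := Algebra.trace_eq_of_algEquiv
    (FiniteField.frobeniusAlgEquivOfAlgebraic (ZMod p) F) x
  rw [canonicalAddChar_apply, canonicalAddChar_apply, ← h]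
  simp [ZMod.card]

/-- With `ζ = e^{2πi/p}`, the value `ζ ^ t` is written as `1 + (ζ - 1) (1 + ζ + ⋯ + ζ ^ (t - 1))`. -/
theorem canonicalAddChar_eq_one_add (p : ℕ) [Fact p.Prime] {F : Type*} [Field F] [Fintype F]
    [Algebra (ZMod p) F] (x : F) :
    canonicalAddChar p F x = 1 + (zeta p - 1) *
      ∑ i ∈ Finset.range (Algebra.trace (ZMod p) F x).val, zeta p ^ i := by
  rw [mul_geom_sum, canonicalAddChar_apply, ZMod.stdAddChar_apply, ZMod.toCircle_apply, zeta,
    ← Complex.exp_nat_mul, add_sub_cancel]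
  congr 1
  ring

theorem sum_eq_add_sum_units {F M : Type*} [Field F] [Fintype F] [AddCommMonoid M]
    [Fintype Fˣ] (f : F → M) : ∑ x, f x = f 0 + ∑ u : Fˣ, f u := by
  classical
  rw [Fintype.sum_eq_add_sum_subtype_ne f 0]
  congr 1
  exact (unitsEquivNeZero.sum_comp fun x : {x : F // x ≠ 0} => f x).symm

theorem valuation_mulChar_le_one (A : ValuationSubring ℂ) {F : Type*} [Field F] [Fintype F]
    (χ : MulChar F ℂ) (x : F) : A.valuation (χ x) ≤ 1 := by
  rcases eq_or_ne x 0 with rfl | hx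
  · rw [MulChar.map_zero, map_zero]
    exact zero_le_one
  · apply valuation_le_one_of_isIntegral
    refine IsIntegral.of_pow (n := Fintype.card F - 1) ?_ ?_
    · have := Fintype.one_lt_card (α := F)
      omega
    · rw [← map_pow, FiniteField.pow_card_sub_one_eq_one x hx, map_one]
      exact isIntegral_one

theorem valuation_mulChar_neg_one (A : ValuationSubring ℂ) {F : Type*} [Field F] [Fintype F]
    (χ : MulChar F ℂ) : A.valuation (χ (-1)) = 1 := by
  have h : χ (-1) * χ (-1) = 1 := by rw [← map_mul]; simp
  rcases mul_self_eq_one_iff.1 h with h | h <;> simp [h]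

theorem mulChar_pow_card_sub_one {F : Type*} [Field F] [Fintype F] (η : MulChar F ℂ) :
    η ^ (Fintype.card F - 1) = 1 := by
  ext u
  rw [MulChar.pow_apply_coe, ← map_pow, FiniteField.pow_card_sub_one_eq_one _ u.ne_zero, map_one,
    MulChar.one_apply_coe]

theorem IsInvTeichmuller.eq_one_of_apply_eq_one {A : ValuationSubring ℂ} {F : Type*} [Field F]
    {ι : F →+* IsLocalRing.ResidueField A} {η : MulChar F ℂ} (hη : IsInvTeichmuller A ι η) {u : F}
    (h : η u = 1) : u = 1 := by
  obtain ⟨a, ha, har⟩ := hη u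
  have ha1 : a = 1 := Subtype.ext (ha.trans h)
  rw [ha1, map_one] at har
  exact ι.injective (by rw [map_one, ← inv_inv (ι u), ← har, inv_one])

section Teichmuller

variable {A : ValuationSubring ℂ} {p : ℕ} [hp : Fact p.Prime]
  {F : Type*} [Field F] [Fintype F] [Algebra (ZMod p) F]
  {ι : F →+* IsLocalRing.ResidueField A} {η : MulChar F ℂ}

theorem IsInvTeichmuller.pow_ne_one (hη : IsInvTeichmuller A ι η) {j : ℕ}
    (hj : ¬ Fintype.card F - 1 ∣ j) : η ^ j ≠ 1 := by
  classical
  intro h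
  apply hj
  obtain ⟨g, hg⟩ := IsCyclic.exists_generator (α := Fˣ)
  rw [← Fintype.card_units, ← Nat.card_eq_fintype_card, ← orderOf_eq_card_of_forall_mem_zpowers hg]
  refine orderOf_dvd_of_pow_eq_one (Units.ext ?_)
  rw [Units.val_pow_eq_pow_val, Units.val_one]
  apply hη.eq_one_of_apply_eq_one
  rw [map_pow, ← MulChar.pow_apply_coe, h, MulChar.one_apply_coe]

variable (η) in
theorem valuation_gaussSum_mul_le {i j : ℕ} (h : η ^ (i + j) ≠ 1) (ψ : AddChar F ℂ) :
    A.valuation (gaussSum (η ^ i) ψ) * A.valuation (gaussSum (η ^ j) ψ) ≤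
      A.valuation (gaussSum (η ^ (i + j)) ψ) := by
  have h1 : η ^ i * η ^ j ≠ 1 := by rwa [← pow_add]
  rw [← map_mul, ← jacobiSum_mul_nontrivial h1 ψ, pow_add, map_mul]
  refine mul_le_of_le_one_right' (A.valuation.map_sum_le fun x _ => ?_)
  rw [map_mul]
  exact mul_le_one' (valuation_mulChar_le_one A _ _) (valuation_mulChar_le_one A _ _)

variable (p η) in
theorem gaussSum_pow_prime_mul {j : ℕ} (hj : j ≠ 0) :
    gaussSum (η ^ (p * j)) (canonicalAddChar p F) = gaussSum (η ^ j) (canonicalAddChar p F) := by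
  have : CharP F p := charP_of_injective_algebraMap (algebraMap (ZMod p) F).injective p
  rw [gaussSum, gaussSum]
  refine Eq.trans ?_ ((frobeniusEquiv F p).toEquiv.sum_comp _)
  refine Finset.sum_congr rfl fun x _ => ?_
  change _ = (η ^ j) (frobenius F p x) * canonicalAddChar p F (frobenius F p x)
  rw [frobenius_def, canonicalAddChar_pow, MulChar.pow_apply' _ (mul_ne_zero hp.out.ne_zero hj),
    MulChar.pow_apply' _ hj, map_pow, ← pow_mul]

/-- The quotient of the Gauss sum by `ζ - 1` reduces to `∑ x⁻¹ Tr x`, which in characteristic `p` is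
`∑ₖ ∑ₓ x ^ (pᵏ - 1) = -1`, only the term `k = 0` contributing. -/
theorem valuation_gaussSum_one (hA : A.valuation (p : ℂ) < 1) (hη : IsInvTeichmuller A ι η)
    (hF : 2 < Fintype.card F) :
    A.valuation (gaussSum η (canonicalAddChar p F)) = A.valuation (zeta p - 1) := by
  classical
  have hη1 : η ≠ 1 := by
    have := hη.pow_ne_one (j := 1) fun h => by
      have := Nat.le_of_dvd one_pos h
      omega
    rwa [pow_one] at this
  have hCF : CharP F p := charP_of_injective_algebraMap (algebraMap (ZMod p) F).injective p
  choose a ha har using hη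
  let z : A := ⟨zeta p, (A.valuation_le_one_iff _).1 (valuation_le_one_of_isIntegral A
    ((zeta_isPrimitiveRoot p).isIntegral hp.out.pos))⟩
  have hz : IsLocalRing.residue A z = 1 := by
    rw [← sub_eq_zero, ← map_one (IsLocalRing.residue A), ← map_sub,
      IsLocalRing.residue_eq_zero_iff, ValuationSubring.valuation_lt_one_iff]
    exact valuation_zeta_sub_one_lt_one hA
  let S : A := ∑ x : F, a x * ∑ i ∈ Finset.range (Algebra.trace (ZMod p) F x).val, z ^ i
  have hg : gaussSum η (canonicalAddChar p F) = (zeta p - 1) * (S : ℂ) := by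
    have hS : (S : ℂ) = ∑ x : F, η x *
        ∑ i ∈ Finset.range (Algebra.trace (ZMod p) F x).val, zeta p ^ i := by
      simp only [S, z, AddSubmonoidClass.coe_finsetSum, MulMemClass.coe_mul, ha,
        SubmonoidClass.coe_pow]
    rw [hS, gaussSum, Finset.mul_sum]
    simp only [canonicalAddChar_eq_one_add, mul_add, mul_one, Finset.sum_add_distrib]
    rw [MulChar.sum_eq_zero_of_ne_one hη1, zero_add]
    exact Finset.sum_congr rfl fun x _ => by ring
  have hSr : IsLocalRing.residue A S = -1 := by
    have h1 : IsLocalRing.residue A S =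
        ι (∑ x : F, x⁻¹ * algebraMap (ZMod p) F (Algebra.trace (ZMod p) F x)) := by
      simp only [S, map_sum, map_mul, map_pow, hz, one_pow, har, Finset.sum_const,
        Finset.card_range, nsmul_eq_mul, mul_one, map_inv₀]
      refine Finset.sum_congr rfl fun x _ => ?_
      congr 1
      conv_rhs => rw [← ZMod.natCast_zmod_val (Algebra.trace (ZMod p) F x)]
      rw [map_natCast, map_natCast]
    have h2 : ∑ x : F, x⁻¹ * algebraMap (ZMod p) F (Algebra.trace (ZMod p) F x) = -1 := by
      simp only [FiniteField.algebraMap_trace_eq_sum_pow, Nat.card_zmod, Finset.mul_sum]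
      rw [Finset.sum_comm]
      set m := Module.finrank (ZMod p) F
      have hm0 : 0 < m := Module.finrank_pos
      have hcard : Fintype.card F = p ^ m := by
        rw [Module.card_eq_pow_finrank (K := ZMod p), ZMod.card]
      have h3 : ∀ k ∈ Finset.range m,
          ∑ x : F, x⁻¹ * x ^ p ^ k = if k = 0 then -1 else 0 := by
        intro k hk
        have hk' : k < m := Finset.mem_range.1 hk
        have hpk : 0 < p ^ k := pow_pos hp.out.pos k
        have h4 : ∑ x : F, x⁻¹ * x ^ p ^ k = ∑ u : Fˣ, (u : F) ^ (p ^ k - 1) := by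
          rw [sum_eq_add_sum_units, inv_zero, zero_mul, zero_add]
          refine Finset.sum_congr rfl fun u _ => ?_
          rw [pow_sub₀ _ u.ne_zero hpk, pow_one, mul_comm]
        rw [h4, FiniteField.sum_pow_units]
        refine if_congr ⟨fun h => ?_, fun h => by simp [h]⟩ rfl rfl
        by_contra hk0
        have h5 : p ^ k < p ^ m := Nat.pow_lt_pow_right hp.out.one_lt hk'
        have h6 : 1 < p ^ k := Nat.one_lt_pow hk0 hp.out.one_lt
        have := Nat.le_of_dvd (by omega) h
        omega
      rw [Finset.sum_congr rfl h3, Finset.sum_ite_eq' , if_pos (Finset.mem_range.2 hm0)]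
    rw [h1, h2, map_neg, map_one]
  have hSu : IsUnit S := by
    rw [← IsLocalRing.residue_ne_zero_iff_isUnit, hSr]
    exact neg_ne_zero.2 one_ne_zero
  rw [hg, map_mul, (A.valuation_eq_one_iff S).1 hSu, mul_one]

/-- The lower bound in Stickelberger's theorem, by induction on `j`: a last digit `0` is removed by
the Frobenius, and a nonzero last digit is lowered by splitting off a factor `η`. -/
theorem le_valuation_gaussSum (hA : A.valuation (p : ℂ) < 1) (hη : IsInvTeichmuller A ι η) (j : ℕ)
    (hj : j < Fintype.card F - 1) :
    A.valuation (zeta p - 1) ^ (Nat.digits p j).sum ≤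
      A.valuation (gaussSum (η ^ j) (canonicalAddChar p F)) := by
  induction j using Nat.strong_induction_on with
  | _ j ih =>
  have hp1 := hp.out.one_lt
  rcases Nat.eq_zero_or_pos j with rfl | hj0
  · rw [pow_zero η, gaussSum_one_left (canonicalAddChar_ne_one p F)]
    simp
  · have hmod := Nat.div_add_mod j p
    rcases Nat.eq_zero_or_pos (j % p) with h0 | h0
    · rw [h0, add_zero] at hmod
      have hdiv : j / p < j := Nat.div_lt_self hj0 hp1
      have hdiv0 : j / p ≠ 0 := by
        intro h
        rw [h, mul_zero] at hmod
        omega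
      have h1 := ih _ hdiv (by omega)
      rw [← gaussSum_pow_prime_mul p η hdiv0, hmod] at h1
      rwa [digits_sum_eq_mod_add_div hp1, h0, zero_add]
    · have h1 := ih (j - 1) (by omega) (by omega)
      have hd : (Nat.digits p j).sum = (Nat.digits p (j - 1)).sum + 1 := by
        have hr := Nat.mod_lt j (by omega : p > 0)
        have hj1 : j - 1 = p * (j / p) + (j % p - 1) := by omega
        rw [hj1, digits_sum_mul_add hp1 _ (by omega), digits_sum_eq_mod_add_div hp1 j]
        omega
      have hne : η ^ (j - 1 + 1) ≠ 1 := hη.pow_ne_one fun h => by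
        have := Nat.le_of_dvd (by omega) h
        omega
      have h2 := valuation_gaussSum_mul_le (A := A) η hne (canonicalAddChar p F)
      rw [pow_one η, valuation_gaussSum_one hA hη (by omega), Nat.sub_add_cancel hj0] at h2
      rw [hd, pow_succ]
      exact (mul_le_mul_left h1 _).trans h2

/-- Stickelberger's theorem on the valuation of Gauss sums. The lower bounds for the indices `j`
and `q - 1 - j` multiply to the known value `q` of the product of the two Gauss sums, so that
both are equalities. -/
theorem valuation_gaussSum (hA : A.valuation (p : ℂ) < 1) (hη : IsInvTeichmuller A ι η)
    {n : ℕ} (hF : Fintype.card F = p ^ n) {j : ℕ} (hj0 : j ≠ 0) (hj : j < Fintype.card F - 1) :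
    A.valuation (gaussSum (η ^ j) (canonicalAddChar p F)) =
      A.valuation (zeta p - 1) ^ (Nat.digits p j).sum := by
  set v := A.valuation
  set ψ := canonicalAddChar p F
  have hψ : ψ.IsPrimitive := AddChar.IsPrimitive.of_ne_one (canonicalAddChar_ne_one p F)
  obtain ⟨j', hjj⟩ : ∃ j', j + j' = Fintype.card F - 1 := ⟨_, Nat.add_sub_cancel' hj.le⟩
  have hne : η ^ j ≠ 1 := hη.pow_ne_one fun h => by
    have := Nat.le_of_dvd (by omega) h
    omega
  have hinv : (η ^ j)⁻¹ = η ^ j' := by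
    rw [inv_eq_iff_mul_eq_one, ← pow_add, hjj, mulChar_pow_card_sub_one]
  have hprod : v (gaussSum (η ^ j) ψ) * v (gaussSum (η ^ j') ψ) =
      v (zeta p - 1) ^ (Nat.digits p j).sum * v (zeta p - 1) ^ (Nat.digits p j').sum := by
    have h1 := congrArg v (gaussSum_mul_gaussSum_eq_card hne hψ)
    rw [hinv, map_mul, hF] at h1
    have h2 := congrArg v (mul_gaussSum_inv_eq_gaussSum (η ^ j') ψ)
    rw [map_mul, valuation_mulChar_neg_one, one_mul] at h2
    rw [h2] at h1
    rw [h1, ← pow_add, digits_sum_complement hp.out.one_lt n j j' (by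
      have := Fintype.card_pos (α := F)
      omega), Nat.cast_pow, map_pow, valuation_prime_eq, ← pow_mul, mul_comm]
  have hpos : ∀ m : ℕ, 0 < v (zeta p - 1) ^ m := fun m =>
    pow_pos (valuation_zeta_sub_one_pos A p) m
  have h1 := le_valuation_gaussSum hA hη j hj
  have h2 := le_valuation_gaussSum hA hη j' (by omega)
  refine le_antisymm (not_lt.1 fun hlt => ?_) h1
  refine hprod.not_gt ?_
  calc _ < v (gaussSum (η ^ j) ψ) * v (zeta p - 1) ^ (Nat.digits p j').sum :=
        mul_lt_mul_of_pos_right hlt (hpos _)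
    _ ≤ _ := mul_le_mul_right h2 _

end Teichmuller

/-! ### Fourier analysis of cubic sums on the multiplicative group -/

theorem gaussSum_eq_sum_units {F : Type*} [Field F] [Fintype F] [Fintype Fˣ] (χ : MulChar F ℂ)
    (ψ : AddChar F ℂ) : gaussSum χ ψ = ∑ u : Fˣ, χ u * ψ u := by
  rw [gaussSum, sum_eq_add_sum_units, MulChar.map_zero, zero_mul, zero_add]

/-- The Mellin coefficients of `a ↦ ∑ₓ ψ(x³ - a x)` are products of two Gauss sums. -/
theorem sum_cubic_sum_mul_mulChar {F : Type*} [Field F] [Fintype F] (ψ : AddChar F ℂ)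
    {φ χ : MulChar F ℂ} (hφ : φ ≠ 1) (h : φ * χ ^ 3 = 1)
    (hcube : Function.Bijective fun u : Fˣ => u ^ 3) :
    ∑ a : F, (∑ x : F, ψ (x ^ 3 - a * x)) * φ (-a) = gaussSum φ ψ * gaussSum χ ψ := by
  classical
  simp only [Finset.sum_mul]
  rw [Finset.sum_comm, sum_eq_add_sum_units]
  have h0 : ∑ a : F, ψ (0 ^ 3 - a * 0) * φ (-a) = 0 := by
    simp only [mul_zero, ne_eq, OfNat.ofNat_ne_zero, not_false_eq_true, zero_pow, sub_zero,
      AddChar.map_zero_eq_one, one_mul]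
    rw [← MulChar.sum_eq_zero_of_ne_one hφ]
    exact Equiv.sum_comp (Equiv.neg F) (fun a => φ a)
  have h1 : ∀ u : Fˣ, ∑ a : F, ψ ((u : F) ^ 3 - a * u) * φ (-a) =
      gaussSum φ ψ * (χ ((u ^ 3 : Fˣ) : F) * ψ ((u ^ 3 : Fˣ) : F)) := by
    intro u
    have hφu : φ ((u⁻¹ : Fˣ) : F) = χ ((u ^ 3 : Fˣ) : F) := by
      have h2 : φ u * χ ((u ^ 3 : Fˣ) : F) = 1 := by
        rw [Units.val_pow_eq_pow_val, map_pow, ← MulChar.pow_apply_coe, ← MulChar.mul_apply, h,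
          MulChar.one_apply_coe]
      have h3 : φ ((u⁻¹ : Fˣ) : F) * φ u = 1 := by
        rw [← map_mul, Units.inv_mul, map_one]
      calc _ = φ ((u⁻¹ : Fˣ) : F) * (φ u * χ ((u ^ 3 : Fˣ) : F)) := by rw [h2, mul_one]
        _ = _ := by rw [← mul_assoc, h3, one_mul]
    -- Substitute `a = -b / u`.
    rw [gaussSum, Finset.sum_mul,
      ← ((Units.mulRight u⁻¹).trans (Equiv.neg F)).sum_comp]
    refine Finset.sum_congr rfl fun b _ => ?_
    simp only [Equiv.trans_apply, Units.mulRight_apply, Equiv.neg_apply, neg_neg, neg_mul,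
      sub_neg_eq_add, Units.inv_mul_cancel_right, map_mul, hφu, AddChar.map_add_eq_mul,
      Units.val_pow_eq_pow_val]
    ring
  rw [h0, zero_add, Finset.sum_congr rfl fun u _ => h1 u, ← Finset.mul_sum,
    hcube.sum_comp fun u : Fˣ => χ (u : F) * ψ (u : F), gaussSum_eq_sum_units χ]

/-- Mellin inversion for the cubic sum, at `a = -α`. -/
theorem sum_gaussSum_mul_gaussSum {F : Type*} [Field F] [Fintype F] (ψ : AddChar F ℂ)
    {η : MulChar F ℂ} (hη : ∀ u : F, η u = 1 → u = 1) (α : Fˣ) :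
    ∑ j ∈ Finset.range (Fintype.card F - 1),
      gaussSum (η ^ j) ψ * gaussSum (η⁻¹ ^ (3 * j)) ψ * (η ^ (3 * j)) α =
    ((Fintype.card F - 1 : ℕ) : ℂ) * ((∑ x : F, ψ (x ^ 3 + α * x)) - 1) := by
  classical
  set N := Fintype.card F - 1
  have horth : ∀ u : Fˣ, ∑ j ∈ Finset.range N, η u ^ j = if u = 1 then (N : ℂ) else 0 := by
    intro u
    split_ifs with hu
    · simp [hu]
    · have h1 : η u - 1 ≠ 0 := sub_ne_zero.2 fun h => hu (Units.ext (hη _ h))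
      have h2 := geom_sum_mul (η u) N
      rw [← map_pow, FiniteField.pow_card_sub_one_eq_one _ u.ne_zero, map_one, sub_self] at h2
      exact (mul_eq_zero.1 h2).resolve_right h1
  have hterm : ∀ j, gaussSum (η ^ j) ψ * gaussSum (η⁻¹ ^ (3 * j)) ψ * (η ^ (3 * j)) α =
      ∑ w : Fˣ, ∑ u : Fˣ, ψ u * ψ w * η ((u * (w⁻¹ * α) ^ 3 : Fˣ) : F) ^ j := by
    intro j
    rw [gaussSum_eq_sum_units, gaussSum_eq_sum_units, mul_comm (∑ u : Fˣ, _), Finset.sum_mul_sum,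
      Finset.sum_mul]
    refine Finset.sum_congr rfl fun w _ => ?_
    rw [Finset.sum_mul]
    refine Finset.sum_congr rfl fun u _ => ?_
    simp only [MulChar.pow_apply_coe, Units.val_mul,
      Units.val_pow_eq_pow_val, map_mul, map_pow, MulChar.inv_apply', Units.val_inv_eq_inv_val]
    ring
  have hsolve : ∀ u w : Fˣ, u * (w⁻¹ * α) ^ 3 = 1 ↔ u = (α⁻¹ * w) ^ 3 := by
    intro u w
    rw [mul_eq_one_iff_eq_inv, ← inv_pow, mul_inv_rev, inv_inv]
  simp only [hterm]
  rw [Finset.sum_comm]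
  have hinner : ∀ w : Fˣ, ∑ j ∈ Finset.range N, ∑ u : Fˣ,
      ψ u * ψ w * η ((u * (w⁻¹ * α) ^ 3 : Fˣ) : F) ^ j =
      N * (ψ (((α⁻¹ * w) ^ 3 : Fˣ) : F) * ψ w) := by
    intro w
    rw [Finset.sum_comm]
    simp only [← Finset.mul_sum, horth, hsolve, mul_ite, mul_zero]
    rw [Finset.sum_ite_eq' , if_pos (Finset.mem_univ _), mul_comm]
  simp only [hinner]
  rw [← Finset.mul_sum, sum_eq_add_sum_units (fun x : F => ψ (x ^ 3 + α * x))]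
  simp only [ne_eq, OfNat.ofNat_ne_zero, not_false_eq_true, zero_pow, mul_zero, add_zero,
    AddChar.map_zero_eq_one, add_sub_cancel_left]
  congr 1
  refine (Equiv.sum_comp (Equiv.mulLeft α) _).symm.trans (Finset.sum_congr rfl fun x _ => ?_)
  rw [Equiv.coe_mulLeft, inv_mul_cancel_left, ← AddChar.map_add_eq_mul, Units.val_mul,
    Units.val_pow_eq_pow_val]

/-- If `3d ≡ 1` modulo `q - 1`, the sums `∑ₓ ψ(x ^ d - a x)` and `∑ₓ ψ(x ^ 3 - b x)` agree for
`a = b⁻³`: substitute `x = (b z)³` and then `z ↦ -z`. -/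
theorem sum_pow_inverse_eq_cubic_sum {F : Type*} [Field F] [Fintype F] (ψ : AddChar F ℂ) {d : ℕ}
    (hd0 : d ≠ 0)
    (hd : 3 * d ≡ 1 [MOD Fintype.card F - 1]) (hcube : Function.Bijective fun u : Fˣ => u ^ 3)
    (b : Fˣ) :
    ∑ x : F, ψ (x ^ d - (((b⁻¹ : Fˣ) ^ 3 : Fˣ) : F) * x) =
      ∑ x : F, ψ (x ^ 3 - b * x) := by
  classical
  rw [sum_eq_add_sum_units, sum_eq_add_sum_units (fun x : F => ψ (x ^ 3 - b * x))]
  congr 1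
  · simp [hd0]
  · rw [← hcube.sum_comp]
    refine (Equiv.sum_comp (Equiv.mulLeft (-b)) _).symm.trans (Finset.sum_congr rfl fun x _ => ?_)
    congr 1
    have hpow : ∀ u : Fˣ, (u ^ 3) ^ d = u := by
      intro u
      rw [← pow_mul]
      have : u ^ (3 * d) = u ^ 1 := by
        rw [pow_eq_pow_iff_modEq]
        refine hd.of_dvd ?_
        rw [← Fintype.card_units]
        exact orderOf_dvd_card
      rw [this, pow_one]
    have h1 : (((-b * x : Fˣ) ^ 3 : Fˣ) : F) ^ d = ((-b * x : Fˣ) : F) := by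
      rw [← Units.val_pow_eq_pow_val, hpow]
    have hb := b.ne_zero
    rw [Equiv.coe_mulLeft, h1]
    simp only [Units.val_mul, Units.val_pow_eq_pow_val, Units.val_neg, Units.val_inv_eq_inv_val]
    field_simp
    ring

/-! ### Valuations of the cubic Weil sums and of their inverses -/

section Cubic

variable {A : ValuationSubring ℂ} {p : ℕ} [hp : Fact p.Prime]
  {F : Type*} [Field F] [Fintype F] [Algebra (ZMod p) F]
  {ι : F →+* IsLocalRing.ResidueField A} {η : MulChar F ℂ}

theorem weilSum_eq_sum_canonicalAddChar (d : ℕ) (a : F) :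
    weilSum p F d a = ∑ x : F, canonicalAddChar p F (x ^ d - a * x) := rfl

theorem weilSum_zero_right {d : ℕ} (hd : d ≠ 0) (hbij : Function.Bijective fun u : Fˣ => u ^ d) :
    weilSum p F d 0 = 0 := by
  classical
  have h := AddChar.sum_eq_zero_of_ne_one (canonicalAddChar_ne_one p F)
  rw [sum_eq_add_sum_units] at h
  rw [weilSum_eq_sum_canonicalAddChar, sum_eq_add_sum_units, ← h]
  congr 1
  · simp [hd]
  · rw [← hbij.sum_comp fun u : Fˣ => canonicalAddChar p F u]
    refine Finset.sum_congr rfl fun u _ => ?_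
    rw [zero_mul, sub_zero, Units.val_pow_eq_pow_val]

/-- In the Mellin expansion of `(q - 1) W(a)` the trivial character contributes `q`, and each other
character a product of two Gauss sums subject to the digit-sum inequality. -/
theorem valuation_weilSum_le (hA : A.valuation (p : ℂ) < 1) (hη : IsInvTeichmuller A ι η)
    {n k : ℕ} (hF : Fintype.card F = p ^ n) (hp5 : 5 ≤ p) (hk : p + 1 = 3 * k)
    (hcop : Nat.Coprime 3 (Fintype.card F - 1)) (α : Fˣ) :
    A.valuation (weilSum p F 3 (-(α : F))) ≤ A.valuation (zeta p - 1) ^ (n * k) := by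
  set v := A.valuation
  set N := Fintype.card F - 1 with hN
  set ψ := canonicalAddChar p F
  have hv1 : v (zeta p - 1) ≤ 1 := (valuation_zeta_sub_one_lt_one hA).le
  have hcard1 : 1 < Fintype.card F := Fintype.one_lt_card
  have hn : n ≠ 0 := by
    rintro rfl
    rw [hF, pow_zero] at hcard1
    exact lt_irrefl _ hcard1
  have hNF : N + 1 = p ^ n := by omega
  have hmellin := sum_gaussSum_mul_gaussSum ψ (fun u => hη.eq_one_of_apply_eq_one (u := u)) α
  have hW : ∑ x : F, ψ (x ^ 3 + α * x) = weilSum p F 3 (-(α : F)) := by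
    rw [weilSum_eq_sum_canonicalAddChar]
    exact Finset.sum_congr rfl fun x _ => by rw [neg_mul, sub_neg_eq_add]
  rw [hW] at hmellin
  obtain ⟨N', hN'⟩ : ∃ N', N = N' + 1 := ⟨N - 1, by omega⟩
  rw [← hN] at hmellin
  have hsum : (N : ℂ) * weilSum p F 3 (-(α : F)) = (p : ℂ) ^ n +
      ∑ j ∈ Finset.range N', gaussSum (η ^ (j + 1)) ψ * gaussSum (η⁻¹ ^ (3 * (j + 1))) ψ *
        (η ^ (3 * (j + 1))) α := by
    have h1 : (p : ℂ) ^ n = N + 1 := by exact_mod_cast hNF.symm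
    have h2 : ∀ m : ℕ, N = m → ∑ j ∈ Finset.range m, gaussSum (η ^ j) ψ *
        gaussSum (η⁻¹ ^ (3 * j)) ψ * (η ^ (3 * j)) α =
        (N : ℂ) * (weilSum p F 3 (-(α : F)) - 1) := by
      rintro m rfl
      exact hmellin
    have h3 := h2 _ hN'
    rw [Finset.sum_range_succ', mul_zero, pow_zero, pow_zero,
      gaussSum_one_left (canonicalAddChar_ne_one p F), MulChar.one_apply_coe] at h3
    rw [h1]
    linear_combination -h3
  have hvq : v ((p : ℂ) ^ n) = v (zeta p - 1) ^ ((p - 1) * n) := by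
    rw [map_pow, valuation_prime_eq, ← pow_mul]
  have hvN : v (N : ℂ) = 1 := by
    have h1 : (N : ℂ) = (p : ℂ) ^ n - 1 := by
      rw [eq_sub_iff_add_eq]
      exact_mod_cast hNF
    rw [h1, Valuation.map_sub_eq_of_lt_right, map_one]
    rw [map_one, map_pow]
    exact pow_lt_one₀ zero_le hA hn
  have hterm : ∀ j ∈ Finset.range N', v (gaussSum (η ^ (j + 1)) ψ *
      gaussSum (η⁻¹ ^ (3 * (j + 1))) ψ * (η ^ (3 * (j + 1))) α) ≤ v (zeta p - 1) ^ (n * k) := by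
    intro j hj
    have hjN : j + 1 < N := by
      have := Finset.mem_range.1 hj
      omega
    generalize hi : j + 1 = i at hjN ⊢
    have hi0 : i ≠ 0 := by omega
    -- The index `m` of the second Gauss sum: `3i + m = c (q - 1)` with `0 < m < q - 1`.
    have hmod0 : 3 * i % N ≠ 0 := by
      intro h
      have h1 := Nat.le_of_dvd (by omega) (hcop.symm.dvd_of_dvd_mul_left (Nat.dvd_of_mod_eq_zero h))
      omega
    have hdm := Nat.div_add_mod (3 * i) N
    have hmlt := Nat.mod_lt (3 * i) (by omega : N > 0)
    obtain ⟨c, hc⟩ : ∃ c, c = 3 * i / N + 1 := ⟨_, rfl⟩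
    obtain ⟨m, hm⟩ : ∃ m, m = N - 3 * i % N := ⟨_, rfl⟩
    have hsumN : 3 * i + m = c * N := by
      rw [hc, add_mul, one_mul, mul_comm _ N]
      omega
    have hc3 : c ≤ 3 := by
      have : 3 * i / N < 3 := Nat.div_lt_of_lt_mul (by omega)
      omega
    have hchar : η⁻¹ ^ (3 * i) = η ^ m := by
      rw [inv_pow, inv_eq_iff_mul_eq_one, ← pow_add, hsumN, mul_comm, pow_mul,
        mulChar_pow_card_sub_one, one_pow]
    have hip : i < p ^ n := by omega
    have hmp : m < p ^ n := by omega
    have hc1 : 1 ≤ c := hc ▸ Nat.le_add_left 1 _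
    have hdig := le_digits_sum_add_digits_sum hp5 (by omega) n i m c c hip hmp
      hc1 hc3 hc1 hc3 (by rw [hsumN, ← hNF]; ring)
    have hle : n * k ≤ (Nat.digits p i).sum + (Nat.digits p m).sum := by
      have h1 : n * (p + 1) = 3 * (n * k) := by rw [hk]; ring
      omega
    rw [map_mul, map_mul, hchar, valuation_gaussSum hA hη hF hi0 hjN,
      valuation_gaussSum hA hη hF (by omega : m ≠ 0) (by omega), ← pow_add]
    exact (mul_le_of_le_one_right' (valuation_mulChar_le_one A _ _)).trans
      (pow_le_pow_right_of_le_one' hv1 hle)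
  have hle : n * k ≤ (p - 1) * n := by
    rw [mul_comm n]
    exact Nat.mul_le_mul_right n (by omega)
  calc v (weilSum p F 3 (-(α : F))) = v ((N : ℂ) * weilSum p F 3 (-(α : F))) := by
        rw [map_mul, hvN, one_mul]
    _ ≤ _ := by
        rw [hsum]
        exact v.map_add_le (hvq ▸ pow_le_pow_right_of_le_one' hv1 hle) (v.map_sum_le hterm)

/-- The lower bound is attained: with `R = 1 + p + ⋯ + p ^ (n - 1)`, the Mellin coefficient with
Gauss sums of indices `R` and `R (p - 2) / 3` has the required valuation. -/
theorem exists_le_valuation_weilSum (hA : A.valuation (p : ℂ) < 1) (hη : IsInvTeichmuller A ι η)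
    {n k : ℕ} (hF : Fintype.card F = p ^ n) (hp5 : 5 ≤ p) (hk : p + 1 = 3 * k)
    (hcube : Function.Bijective fun u : Fˣ => u ^ 3) :
    ∃ a : F, A.valuation (zeta p - 1) ^ (n * k) ≤ A.valuation (weilSum p F 3 a) := by
  by_contra! hcon
  set v := A.valuation
  set ψ := canonicalAddChar p F
  have hcard1 : 1 < Fintype.card F := Fintype.one_lt_card
  set R := ∑ i ∈ Finset.range n, p ^ i with hR
  have hgeom : (p - 1) * R = Fintype.card F - 1 := by
    rw [hF, hR, mul_comm]
    have h1 := Nat.geomSum_eq (by omega : 2 ≤ p) n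
    have h2 : (p - 1) ∣ p ^ n - 1 := by simpa using Nat.sub_dvd_pow_sub_pow p 1 n
    rw [h1, Nat.div_mul_cancel h2]
  have hR0 : 0 < R := Nat.pos_of_ne_zero fun h => by
    rw [h, mul_zero] at hgeom
    omega
  obtain ⟨r, hr⟩ : ∃ r, k = r + 1 := ⟨k - 1, by omega⟩
  have h3 : 3 * (r * R) + R = Fintype.card F - 1 := by
    rw [← hgeom, show p - 1 = 3 * r + 1 by omega]
    ring
  have hrR : 0 < r * R := Nat.mul_pos (by omega) hR0
  have hne : η ^ R ≠ 1 := hη.pow_ne_one fun h => by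
    have := Nat.le_of_dvd hR0 h
    omega
  have hcoef := congrArg v (sum_cubic_sum_mul_mulChar ψ (φ := η ^ R) (χ := η ^ (r * R)) hne
    (by rw [← pow_mul, ← pow_add, show R + r * R * 3 = Fintype.card F - 1 by omega,
      mulChar_pow_card_sub_one]) hcube)
  have hd1 : (Nat.digits p R).sum = n := by
    have := digits_sum_repdigit hp.out.one_lt (r := 1) (by omega) n
    rwa [one_mul, mul_one] at this
  have hd2 : (Nat.digits p (r * R)).sum = n * r :=
    digits_sum_repdigit hp.out.one_lt (by omega) n
  rw [map_mul, valuation_gaussSum hA hη hF hR0.ne' (by omega),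
    valuation_gaussSum hA hη hF hrR.ne' (by omega), hd1, hd2, ← pow_add,
    show n + n * r = n * k by rw [hr]; ring] at hcoef
  refine hcoef.not_lt (v.map_sum_lt' (pow_pos (valuation_zeta_sub_one_pos A p) _) fun a _ => ?_)
  rw [map_mul]
  exact (mul_le_of_le_one_right' (valuation_mulChar_le_one A _ _)).trans_lt (hcon a)

theorem isIntegral_weilSum (d : ℕ) (a : F) :
    IsIntegral ℤ (⟨weilSum p F d a, weilSum_mem p F d a⟩ : cyclo p) := by
  rw [← isIntegral_algebraMap_iff (B := ℂ) (algebraMap (cyclo p) ℂ).injective]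
  change IsIntegral ℤ (weilSum p F d a)
  refine IsIntegral.sum _ fun x _ => IsIntegral.of_pow hp.out.pos (n := p) ?_
  change IsIntegral ℤ (canonicalAddChar p F _ ^ p)
  have : CharP F p := charP_of_injective_algebraMap (algebraMap (ZMod p) F).injective p
  rw [← AddChar.map_nsmul_eq_pow, nsmul_eq_mul, CharP.cast_eq_zero, zero_mul, AddChar.map_zero_eq_one]
  exact isIntegral_one

/-- A valuation is at most that of `(ζ - 1) ^ m` when `val` is at least `m / (p - 1)`. The lower
bound in `hge` also forces the Weil sum to be nonzero. -/
theorem minVal_eq_of_valuation (hA : A.valuation (p : ℂ) < 1) {d m : ℕ}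
    (hle : ∀ a : F, A.valuation (weilSum p F d a) ≤ A.valuation (zeta p - 1) ^ m)
    (hge : ∃ a : F, A.valuation (zeta p - 1) ^ m ≤ A.valuation (weilSum p F d a)) :
    minVal p F d = (((m : ℚ) / ((p : ℚ) - 1) : ℚ) : WithTop ℚ) := by
  have hπ0 := valuation_zeta_sub_one_pos A p
  have hπ1 := valuation_zeta_sub_one_lt_one hA
  have hp1 : (0 : ℚ) ≤ (p : ℚ) - 1 := by
    have : (1 : ℚ) < p := by exact_mod_cast hp.out.one_lt
    linarith
  apply le_antisymm
  · obtain ⟨a, ha⟩ := hge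
    refine (Finset.inf_le (Finset.mem_univ a)).trans ?_
    have hne : (⟨weilSum p F d a, weilSum_mem p F d a⟩ : cyclo p) ≠ 0 := by
      intro h
      have h1 : weilSum p F d a = 0 := congrArg Subtype.val h
      rw [h1, map_zero] at ha
      exact (pow_pos hπ0 m).not_ge ha
    obtain ⟨k, hk1, hk2⟩ := exists_val_eq_and_valuation_eq hA (isIntegral_weilSum d a) hne
    rw [hk1, WithTop.coe_le_coe]
    change A.valuation (weilSum p F d a) = _ at hk2
    rw [hk2] at ha
    have hkm : k ≤ m := (pow_le_pow_iff_right_of_lt_one₀ hπ0 hπ1).1 ha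
    gcongr
  · refine Finset.le_inf fun a _ => ?_
    by_cases hne : (⟨weilSum p F d a, weilSum_mem p F d a⟩ : cyclo p) = 0
    · rw [val, if_pos hne]
      exact le_top
    · obtain ⟨k, hk1, hk2⟩ := exists_val_eq_and_valuation_eq hA (isIntegral_weilSum d a) hne
      rw [hk1, WithTop.coe_le_coe]
      change A.valuation (weilSum p F d a) = _ at hk2
      have ha := hle a
      rw [hk2] at ha
      have hkm : m ≤ k := (pow_le_pow_iff_right_of_lt_one₀ hπ0 hπ1).1 ha
      gcongr

variable (p F) in
/-- The value `n k / (p - 1)`, where `k = (p + 1) / 3`, for the exponent `3` and its inverse. -/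
theorem minVal_three_and_minVal_inverse {n k d : ℕ} (hF : Fintype.card F = p ^ n) (hp5 : 5 ≤ p)
    (hk : p + 1 = 3 * k) (hcop : Nat.Coprime 3 (Fintype.card F - 1)) (hd0 : d ≠ 0)
    (hd : 3 * d ≡ 1 [MOD Fintype.card F - 1]) :
    minVal p F 3 = ((((n * k : ℕ) : ℚ) / ((p : ℚ) - 1) : ℚ) : WithTop ℚ) ∧
      minVal p F d = ((((n * k : ℕ) : ℚ) / ((p : ℚ) - 1) : ℚ) : WithTop ℚ) := by
  classical
  obtain ⟨A, hA⟩ := exists_valuationSubring_lt_one p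
  obtain ⟨ι, η, hη⟩ := exists_isInvTeichmuller hA F
  have hcube : Function.Bijective fun u : Fˣ => u ^ 3 :=
    (powCoprime (G := Fˣ) (n := 3) (by
      rw [Nat.card_eq_fintype_card, Fintype.card_units]
      exact hcop.symm)).bijective
  have hdpow : Function.Bijective fun u : Fˣ => u ^ d :=
    (powCoprime (G := Fˣ) (n := d) (by
      rw [Nat.card_eq_fintype_card, Fintype.card_units]
      exact (Nat.Coprime.coprime_mul_left (k := 3) (by
        rw [Nat.Coprime, hd.gcd_eq, Nat.gcd_one_left])).symm)).bijective
  have hle3 : ∀ a : F, A.valuation (weilSum p F 3 a) ≤ A.valuation (zeta p - 1) ^ (n * k) := by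
    intro a
    rcases eq_or_ne a 0 with rfl | ha
    · rw [weilSum_zero_right three_ne_zero hcube, map_zero]
      exact zero_le
    · have := valuation_weilSum_le hA hη hF hp5 hk hcop (-(Units.mk0 a ha))
      rwa [Units.val_neg, neg_neg, Units.val_mk0] at this
  have hge3 := exists_le_valuation_weilSum hA hη hF hp5 hk hcube
  have hswap : ∀ b : Fˣ, weilSum p F d (((b⁻¹ : Fˣ) ^ 3 : Fˣ) : F) = weilSum p F 3 b := fun b =>
    sum_pow_inverse_eq_cubic_sum (canonicalAddChar p F) hd0 hd hcube b
  refine ⟨minVal_eq_of_valuation hA hle3 hge3, minVal_eq_of_valuation hA ?_ ?_⟩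
  · intro a
    rcases eq_or_ne a 0 with rfl | ha
    · rw [weilSum_zero_right hd0 hdpow, map_zero]
      exact zero_le
    · obtain ⟨b, hb⟩ := hcube.surjective (Units.mk0 a ha)
      have h1 := hswap b⁻¹
      rw [inv_inv, show b ^ 3 = Units.mk0 a ha from hb, Units.val_mk0] at h1
      rw [h1]
      exact hle3 _
  · obtain ⟨a, ha⟩ := hge3
    rcases eq_or_ne a 0 with rfl | ha0
    · rw [weilSum_zero_right three_ne_zero hcube, map_zero] at ha
      exact absurd ha (pow_pos (valuation_zeta_sub_one_pos A p) _).not_ge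
    · exact ⟨_, ha.trans_eq (congrArg A.valuation (hswap (Units.mk0 a ha0)).symm)⟩

end Cubic

end WeilSum

theorem lemma5p8 (p n q : ℕ) [Fact p.Prime] (F : Type*) [Field F] [Fintype F]
    [Algebra (ZMod p) F] (hF : Fintype.card F = q) (hq : q = p ^ n)
    (hodd : Odd p) (hp : p ≡ 2 [MOD 3]) :
    ¬ 3 ≡ 1 [MOD p - 1] ∧
    (Nat.gcd 3 (q - 1) = 1 ↔ q ≡ 2 [MOD 3]) ∧
    (Nat.gcd 3 (q - 1) = 1 →
      ∃ d : ℕ, (d : ℚ) = (2 * (q : ℚ) - 1) / 3 ∧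
        3 * d ≡ 1 [MOD q - 1] ∧
        WeilSum.minVal p F 3 = ((n * ((p + 1) / (3 * (p - 1))) : ℚ) : WithTop ℚ) ∧
        WeilSum.minVal p F d = ((n * ((p + 1) / (3 * (p - 1))) : ℚ) : WithTop ℚ) ∧
        ¬ d ≡ 1 [MOD p - 1]) := by
  have hp3 : p % 3 = 2 := hp
  have hp5 : 5 ≤ p := by
    have hmod := Nat.odd_iff.1 hodd
    have := (Fact.out : p.Prime).two_le
    omega
  have hcard1 : 1 < q := hF ▸ Fintype.one_lt_card
  have h31 : ¬ 3 ≡ 1 [MOD p - 1] := by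
    intro h
    have h1 := Nat.le_of_dvd two_pos ((Nat.modEq_iff_dvd' (by norm_num)).1 h.symm)
    omega
  have hq3 : q % 3 ≠ 0 := by
    intro h
    rw [hq] at h
    have h1 := (Nat.prime_three.dvd_of_dvd_pow (Nat.dvd_of_mod_eq_zero h))
    omega
  have hgcd : Nat.gcd 3 (q - 1) = 1 ↔ q ≡ 2 [MOD 3] := by
    change Nat.Coprime 3 (q - 1) ↔ q % 3 = 2
    rw [Nat.prime_three.coprime_iff_not_dvd]
    omega
  refine ⟨h31, hgcd, fun hcop => ?_⟩
  have hq2 : q % 3 = 2 := hgcd.1 hcop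
  obtain ⟨d, hd⟩ : ∃ d, 3 * d = 2 * q - 1 := ⟨(2 * q - 1) / 3, by omega⟩
  have hd1 : 3 * d ≡ 1 [MOD q - 1] := by
    rw [hd, show 2 * q - 1 = 1 + (q - 1) * 2 by omega]
    exact Nat.add_mul_mod_self_left 1 (q - 1) 2
  obtain ⟨k, hk⟩ : ∃ k, p + 1 = 3 * k := ⟨(p + 1) / 3, by omega⟩
  have hval : ((n * k : ℕ) : ℚ) / ((p : ℚ) - 1) = n * ((p + 1) / (3 * (p - 1))) := by
    have h1 : (p : ℚ) + 1 = 3 * k := by exact_mod_cast hk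
    have h2 : (p : ℚ) - 1 ≠ 0 := by
      have : (5 : ℚ) ≤ p := by exact_mod_cast hp5
      linarith
    rw [h1]
    push_cast
    field_simp
  obtain ⟨hv3, hvd⟩ := WeilSum.minVal_three_and_minVal_inverse p F (hF.trans hq) hp5 hk
    (hF.symm ▸ hcop) (by omega) (hF.symm ▸ hd1)
  refine ⟨d, ?_, hd1, hval ▸ hv3, hval ▸ hvd, fun hd2 => ?_⟩
  · have h1 : 3 * d + 1 = 2 * q := by omega
    have h2 : 3 * (d : ℚ) + 1 = 2 * q := by exact_mod_cast h1
    linarith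
  -- `p - 1` divides `q - 1`, so that `d ≡ 1` would give `1 ≡ 3d ≡ 3` modulo `p - 1`.
  · have hdvd : p - 1 ∣ q - 1 := by
      rw [hq]
      simpa using Nat.sub_dvd_pow_sub_pow p 1 n
    exact h31 (((hd2.mul_left 3).symm.trans (hd1.of_dvd hdvd)))
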